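/- Let $\mathbb{F}$ be a field, let $N \ge 1$ and $d \ge 0$ be integers, and let $E$ be the natural $2$-dimensional representation of $\mathrm{SL}_2(\mathbb{F})$, with standard basis $X, Y$. For $c \ge 0$ let $\mathrm{Sym}^c E$ be the symmetric power (a quotient of $E^{\otimes c}$), with basis the monomials $X^{c-i}Y^i$, $0 \le i \le c$. For a representation $V$ of $\mathrm{SL}_2(\mathbb{F})$ let $\Delta^{(2,1^{N-1})}V$ be the kernel of the multiplication map \[ \textstyle\bigwedge^N V \otimes V \to \bigwedge^{N+1} V, \qquad v_1 \wedge \cdots \wedge v_N \otimes w \mapsto v_1 \wedge \cdots \wedge v_N \wedge w, \] a subrepresentation of $\bigwedge^N V \otimes V$. For $\mathbf{i} = (i_1,\ldots,i_r) \in \{0,1,\ldots,c\}^r$ put $|\mathbf{i}| = i_1 + \cdots + i_r$ and \[ F^{(c)}_\wedge(\mathbf{i}) = X^{c-i_1}Y^{i_1} \wedge \cdots \wedge X^{c-i_r}Y^{i_r} \in \textstyle\bigwedge^r \mathrm{Sym}^c E. \] Let \[ \phi : \mathrm{Sym}^{N-1}E \otimes \textstyle\bigwedge^{N+1}\mathrm{Sym}^{d+1}E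 \to \bigwedge^N \mathrm{Sym}^d E \otimes \mathrm{Sym}^d E \] be the $\mathbb{F}$-linear map defined on the canonical basis by \[ \phi\bigl( X^{N-1-s}Y^s \otimes F^{(d+1)}_\wedge(\mathbf{k}) \bigr) = \sum_{\mathbf{i}} F^{(d)}_\wedge(\mathbf{i}) \otimes X^{d-j(\mathbf{i})}Y^{j(\mathbf{i})}, \qquad j(\mathbf{i}) = s + |\mathbf{k}| - N - |\mathbf{i}|, \] for $0 \le s \le N-1$ and $\mathbf{k} = (k_1,\ldots,k_{N+1})$ with $0 \le k_1 < \cdots < k_{N+1} \le d+1$, where the sum is over all integer tuples $\mathbf{i} = (i_1,\ldots,i_N)$ with $k_\alpha \le i_\alpha < k_{\alpha+1}$ for $1 \le \alpha \le N$; for each of these $0 \le j(\mathbf{i}) \le d$. Then the image of $\phi$ is contained in $\Delta^{(2,1^{N-1})}\mathrm{Sym}^d E$, and $\phi$ is an isomorphism of representations of $\mathrm{SL}_2(\mathbb{F})$ \[ \mathrm{Sym}^{N-1}E \otimes \textstyle\bigwedge^{N+1} \mathrm{Sym}^{d+1}E \;\cong\; \Delta^{(2,1^{N-1})}\mathrm{Sym}^d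 E. \] -/

import Mathlib

open scoped TensorProduct

noncomputable section

namespace Plethysm

/-! ### Symmetric powers -/

section Sym

variable {F : Type*} [Field F] {V W : Type*} [AddCommGroup V] [Module F V]
  [AddCommGroup W] [Module F W]

/-- The symmetric power `Sym^c V`, a quotient of `V^{⊗ c}`, realised as the degree `c` part of the
symmetric algebra of `V`, exactly as Mathlib realises `⋀[F]^c V` inside the exterior algebra. -/
abbrev SymPow (F : Type*) [Field F] (c : ℕ) (V : Type*) [AddCommGroup V] [Module F V] :
    Submodule F (SymmetricAlgebra F V) :=
  LinearMap.range (SymmetricAlgebra.ι F V) ^ c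

/-- The algebra homomorphism `Sym V → Sym W` induced by a linear map `V → W`. -/
def symAlgMap (f : V →ₗ[F] W) : SymmetricAlgebra F V →ₐ[F] SymmetricAlgebra F W :=
  SymmetricAlgebra.lift (SymmetricAlgebra.ι F W ∘ₗ f)

lemma symAlgMap_ι (f : V →ₗ[F] W) (v : V) :
    symAlgMap f (SymmetricAlgebra.ι F V v) = SymmetricAlgebra.ι F W (f v) := by
  simp [symAlgMap]

lemma symAlgMap_mem (c : ℕ) (f : V →ₗ[F] W) (x : SymmetricAlgebra F V) (hx : x ∈ SymPow F c V) :
    symAlgMap f x ∈ SymPow F c W := by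
  have h : (SymPow F c V).map (symAlgMap f).toLinearMap ≤ SymPow F c W := by
    rw [SymPow, Submodule.map_pow]
    refine pow_le_pow_left' ?_ c
    rintro _ ⟨_, ⟨v, rfl⟩, rfl⟩
    exact ⟨f v, (symAlgMap_ι f v).symm⟩
  exact h ⟨x, hx, rfl⟩

/-- The linear map `Sym^c V → Sym^c W` induced by a linear map `V → W`. -/
def symMap (c : ℕ) (f : V →ₗ[F] W) : SymPow F c V →ₗ[F] SymPow F c W :=
  (symAlgMap f).toLinearMap.restrict (symAlgMap_mem c f)

/-- The representation `Sym^c V` of `G`, for a representation `V` of `G`. -/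
def symRep {G : Type*} [Monoid G] (c : ℕ) (ρ : Representation F G V) :
    Representation F G (SymPow F c V) where
  toFun g := symMap c (ρ g)
  map_one' := by
    have h : symAlgMap (ρ 1) = AlgHom.id F (SymmetricAlgebra F V) := by
      ext v; simp [symAlgMap_ι]
    ext x
    change symAlgMap (ρ 1) (x : SymmetricAlgebra F V) = x
    rw [h]; rfl
  map_mul' g g' := by
    have h : symAlgMap (ρ (g * g')) = (symAlgMap (ρ g)).comp (symAlgMap (ρ g')) := by
      ext v; simp [symAlgMap_ι]
    ext x
    change symAlgMap (ρ (g * g')) (x : SymmetricAlgebra F V) = symAlgMap (ρ g) (symAlgMap (ρ g') x)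
    rw [h]; rfl

end Sym

/-! ### Exterior powers and the Schur functor `Δ^{(2,1^{N-1})}` -/

section Delta

variable {F : Type*} [Field F] {V : Type*} [AddCommGroup V] [Module F V] {G : Type*} [Monoid G]

/-- The representation `⋀^n V` of `G`, for a representation `V` of `G`. -/
def extRep (n : ℕ) (ρ : Representation F G V) : Representation F G (⋀[F]^n V) where
  toFun g := exteriorPower.map n (ρ g)
  map_one' := by rw [map_one]; exact exteriorPower.map_id
  map_mul' g g' := by rw [map_mul, Module.End.mul_eq_comp, Module.End.mul_eq_comp, exteriorPower.map_comp]

/-- The multiplication map `μ_N : ⋀^N V ⊗ V → ⋀^{N+1} V`, `x ⊗ w ↦ x ∧ w`. -/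
def mu (F : Type*) [Field F] (N : ℕ) (V : Type*) [AddCommGroup V] [Module F V] :
    (⋀[F]^N V) ⊗[F] V →ₗ[F] ⋀[F]^(N + 1) V :=
  TensorProduct.lift <| LinearMap.mk₂ F
    (fun x w ↦ ⟨(x : ExteriorAlgebra F V) * ExteriorAlgebra.ι F w, by
      rw [ExteriorAlgebra.exteriorPower, pow_succ]
      exact Submodule.mul_mem_mul x.2 ⟨w, rfl⟩⟩)
    (fun x x' w ↦ Subtype.ext (by simp [add_mul]))
    (fun a x w ↦ Subtype.ext (by simp))
    (fun x w w' ↦ Subtype.ext (by simp [mul_add]))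
    (fun a x w ↦ Subtype.ext (by simp))

lemma mu_tmul (N : ℕ) (x : ⋀[F]^N V) (w : V) :
    (mu F N V (x ⊗ₜ w) : ExteriorAlgebra F V) = x * ExteriorAlgebra.ι F w := rfl

/-- The vector space `Δ^{(2,1^{N-1})} V = ker μ_N`. -/
abbrev Delta (F : Type*) [Field F] (N : ℕ) (V : Type*) [AddCommGroup V] [Module F V] :
    Submodule F ((⋀[F]^N V) ⊗[F] V) :=
  LinearMap.ker (mu F N V)

lemma exteriorPower_map_coe (N : ℕ) (f : V →ₗ[F] V) (x : ⋀[F]^N V) :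
    (exteriorPower.map N f x : ExteriorAlgebra F V) = ExteriorAlgebra.map f x := by
  have h : (⋀[F]^N V).subtype ∘ₗ exteriorPower.map N f =
      (ExteriorAlgebra.map f).toLinearMap ∘ₗ (⋀[F]^N V).subtype := by
    ext v
    simp
  exact LinearMap.congr_fun h x

lemma mu_map (N : ℕ) (f : V →ₗ[F] V) :
    mu F N V ∘ₗ TensorProduct.map (exteriorPower.map N f) f =
      exteriorPower.map (N + 1) f ∘ₗ mu F N V := by
  refine TensorProduct.ext' fun x w ↦ Subtype.ext ?_
  simp only [LinearMap.comp_apply, TensorProduct.map_tmul, exteriorPower_map_coe, mu_tmul]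
  simp

/-- The representation `Δ^{(2,1^{N-1})} V` of `G`, for a representation `V` of `G`: the
subrepresentation `ker μ_N` of `⋀^N V ⊗ V`. -/
def deltaRep (N : ℕ) (ρ : Representation F G V) : Representation F G (Delta F N V) :=
  ((extRep N ρ).tprod ρ).subrepresentation (Delta F N V) fun g x hx ↦ by
    rw [Submodule.mem_comap, LinearMap.mem_ker]
    have h := LinearMap.congr_fun (mu_map N (ρ g)) x
    rw [LinearMap.comp_apply, LinearMap.comp_apply, LinearMap.mem_ker.1 hx, map_zero] at h
    exact h

end Delta

/-! ### The natural representation and the map `φ` -/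

section Phi

variable (F : Type*) [Field F]

/-- The underlying space of the natural representation of `SL_2(F)`. -/
abbrev E : Type _ := Fin 2 → F

/-- The natural representation `E` of `SL_2(F)`, by multiplication of column vectors. -/
def natRep : Representation F (Matrix.SpecialLinearGroup (Fin 2) F) (E F) where
  toFun g := Matrix.toLin' (g : Matrix (Fin 2) (Fin 2) F)
  map_one' := by rw [Matrix.SpecialLinearGroup.coe_one]; exact Matrix.toLin'_one
  map_mul' g g' := by rw [Matrix.SpecialLinearGroup.coe_mul]; exact Matrix.toLin'_mul _ _

/-- The first basis vector of `E`, as an element of the symmetric algebra. -/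
def X : SymmetricAlgebra F (E F) := SymmetricAlgebra.ι F (E F) (Pi.single 0 1)

/-- The second basis vector of `E`, as an element of the symmetric algebra. -/
def Y : SymmetricAlgebra F (E F) := SymmetricAlgebra.ι F (E F) (Pi.single 1 1)

lemma range_ι_eq : LinearMap.range (SymmetricAlgebra.ι F (E F)) = Submodule.span F {X F, Y F} := by
  have h : Set.range (Pi.basisFun F (Fin 2)) = {Pi.single 0 1, Pi.single 1 1} := by
    ext v
    simp [Fin.exists_fin_two, eq_comm]
  rw [LinearMap.range_eq_map, ← (Pi.basisFun F (Fin 2)).span_eq, h, Submodule.map_span,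
    Set.image_pair]
  rfl

lemma monomial_mem (c : ℕ) (i : Fin (c + 1)) :
    X F ^ (c - i.val) * Y F ^ i.val ∈ SymPow F c (E F) := by
  have hc : c = (c - i.val) + i.val := by omega
  have h := Submodule.mul_mem_mul
    (Submodule.pow_mem_pow (LinearMap.range (SymmetricAlgebra.ι F (E F))) (x := X F) ⟨_, rfl⟩
      (c - i.val))
    (Submodule.pow_mem_pow (LinearMap.range (SymmetricAlgebra.ι F (E F))) (x := Y F) ⟨_, rfl⟩ i.val)
  rw [← pow_add, ← hc] at h
  exact h

/-- The monomial `X^{c-i} Y^i` in `Sym^c E`, for `0 ≤ i ≤ c`. -/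
def monomial (c : ℕ) (i : Fin (c + 1)) : SymPow F c (E F) :=
  ⟨X F ^ (c - i.val) * Y F ^ i.val, monomial_mem F c i⟩

lemma monomial_linearIndependent (c : ℕ) : LinearIndependent F (monomial F c) := by
  let b := Pi.basisFun F (Fin 2)
  let e := SymmetricAlgebra.equivMvPolynomial b
  let m : Fin (c + 1) → (Fin 2 →₀ ℕ) := fun i ↦
    Finsupp.single 0 (c - i.val) + Finsupp.single 1 i.val
  have hm : Function.Injective m := fun i j hij ↦ by
    have h := DFunLike.congr_fun hij 1
    simpa [m, Fin.val_inj] using h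
  have h := (MvPolynomial.basisMonomials (Fin 2) F).linearIndependent.comp m hm
  have hX : e (X F) = MvPolynomial.X 0 := by
    have := SymmetricAlgebra.equivMvPolynomial_ι_apply b 0
    simpa [b, X, e] using this
  have hY : e (Y F) = MvPolynomial.X 1 := by
    have := SymmetricAlgebra.equivMvPolynomial_ι_apply b 1
    simpa [b, Y, e] using this
  refine LinearIndependent.of_comp (e.toLinearMap ∘ₗ (SymPow F c (E F)).subtype) ?_
  convert! h using 1
  ext1 i
  simp [monomial, hX, hY, m, MvPolynomial.X_pow_eq_monomial, MvPolynomial.monomial_mul]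

lemma mul_mem_span_monomials (c : ℕ) (S : Submodule F (SymmetricAlgebra F (E F)))
    (hS : S = Submodule.span F
      (Set.range fun i : Fin (c + 1) ↦ X F ^ (c - i.val) * Y F ^ i.val)) :
    S * Submodule.span F {X F, Y F} ≤ Submodule.span F
      (Set.range fun i : Fin (c + 2) ↦ X F ^ (c + 1 - i.val) * Y F ^ i.val) := by
  rw [hS, Submodule.span_mul_span]
  refine Submodule.span_mono ?_
  rintro _ ⟨_, ⟨i, rfl⟩, y, hy, rfl⟩
  rcases hy with rfl | rfl
  · refine ⟨i.castSucc, ?_⟩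
    have : c + 1 - i.val = (c - i.val) + 1 := by omega
    simp only [Fin.val_castSucc, this]
    ring
  · refine ⟨i.succ, ?_⟩
    simp only [Fin.val_succ, Nat.add_sub_add_right]
    ring

lemma symPow_le_span (c : ℕ) : SymPow F c (E F) ≤ Submodule.span F
    (Set.range fun i : Fin (c + 1) ↦ X F ^ (c - i.val) * Y F ^ i.val) := by
  induction c with
  | zero => simp [SymPow, Submodule.one_eq_span]
  | succ c ih =>
    rw [SymPow, pow_succ]
    refine (mul_le_mul' ih (range_ι_eq F).le).trans ?_
    exact mul_mem_span_monomials F c _ rfl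

lemma monomial_span (c : ℕ) : ⊤ ≤ Submodule.span F (Set.range (monomial F c)) := by
  rintro ⟨x, hx⟩ -
  have h : (SymPow F c (E F)).subtype '' Set.range (monomial F c) =
      Set.range fun i : Fin (c + 1) ↦ X F ^ (c - i.val) * Y F ^ i.val := by
    rw [← Set.range_comp]; rfl
  have hx' := symPow_le_span F c hx
  rw [← h, ← Submodule.map_span] at hx'
  obtain ⟨y, hy, hyx⟩ := hx'
  have : y = ⟨x, hx⟩ := Subtype.ext hyx
  exact this ▸ hy

/-- The basis of `Sym^c E` of the monomials `X^{c-i} Y^i` for `0 ≤ i ≤ c`. -/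
def symBasis (c : ℕ) : Module.Basis (Fin (c + 1)) F (SymPow F c (E F)) :=
  Module.Basis.mk (monomial_linearIndependent F c) (monomial_span F c)

/-- The element `F_∧^{(c)}(i) = X^{c-i_1}Y^{i_1} ∧ ⋯ ∧ X^{c-i_r}Y^{i_r}` of `⋀^r Sym^c E`. -/
def wedge (c r : ℕ) (i : Fin r → Fin (c + 1)) : ⋀[F]^r (SymPow F c (E F)) :=
  exteriorPower.ιMulti F r fun α ↦ monomial F c (i α)

/-- The basis of `⋀^r Sym^c E` of the `F_∧^{(c)}(k)` for `k` a strictly increasing multi-index. -/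
def wedgeBasis (c r : ℕ) : Module.Basis (Fin r ↪o Fin (c + 1)) F (⋀[F]^r (SymPow F c (E F))) :=
  ((symBasis F c).exteriorPower r).reindex Set.powersetCard.ofFinEmbEquiv.symm

lemma symBasis_apply (c : ℕ) (i : Fin (c + 1)) : symBasis F c i = monomial F c i := by
  simp [symBasis]

lemma wedgeBasis_apply (c r : ℕ) (k : Fin r ↪o Fin (c + 1)) :
    wedgeBasis F c r k = wedge F c r k := by
  simp only [wedgeBasis, Module.Basis.reindex_apply, Equiv.symm_symm, exteriorPower.basis_apply,
    exteriorPower.ιMulti_family, Equiv.symm_apply_apply, wedge]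
  congr 1
  ext1 α
  exact symBasis_apply F c (k α)

/-- The element `F(i, j) = F_∧^{(d)}(i) ⊗ X^{d-j}Y^j` of `⋀^N Sym^d E ⊗ Sym^d E`. -/
def FElt (d N : ℕ) (i : Fin N → Fin (d + 1)) (j : Fin (d + 1)) :
    (⋀[F]^N (SymPow F d (E F))) ⊗[F] SymPow F d (E F) :=
  wedge F d N i ⊗ₜ monomial F d j

/-- The box `B(k) = [k_1,k_2) × ⋯ × [k_N,k_{N+1})`, a set of multi-indices with `N` entries in
`{0,…,d}`, for `k` a strictly increasing multi-index with `N + 1` entries in `{0,…,d+1}`. -/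
def box {d N : ℕ} (k : Fin (N + 1) ↪o Fin (d + 2)) : Finset (Fin N → Fin (d + 1)) :=
  Finset.univ.filter fun i ↦
    ∀ α : Fin N, (k α.castSucc).val ≤ (i α).val ∧ (i α).val < (k α.succ).val

lemma sum_add_le_of_mem_box {d N : ℕ} {k : Fin (N + 1) ↪o Fin (d + 2)} {i : Fin N → Fin (d + 1)}
    (hi : i ∈ box k) : N + ∑ α, (i α).val ≤ ∑ α, (k α).val := by
  have h : ∑ α : Fin N, ((i α).val + 1) ≤ ∑ α : Fin N, (k α.succ).val :=
    Finset.sum_le_sum fun α _ ↦ ((Finset.mem_filter.1 hi).2 α).2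
  rw [Finset.sum_add_distrib] at h
  rw [Fin.sum_univ_succ]
  simp only [Finset.sum_const, Finset.card_univ, Fintype.card_fin, smul_eq_mul, mul_one] at h
  omega

/-- If `i ∈ B(k)` then `s + |k| - N - |i|` lies in `{0,…,d}`; by `sum_add_le_of_mem_box` the
subtraction of natural numbers is not truncated. -/
lemma index_lt {d N : ℕ} (hN : 1 ≤ N) (s : Fin (N - 1 + 1)) {k : Fin (N + 1) ↪o Fin (d + 2)}
    {i : Fin N → Fin (d + 1)} (hi : i ∈ box k) :
    s.val + (∑ α, (k α).val) - N - ∑ α, (i α).val < d + 1 := by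
  have h : ∑ α : Fin N, (k α.castSucc).val ≤ ∑ α : Fin N, (i α).val :=
    Finset.sum_le_sum fun α _ ↦ ((Finset.mem_filter.1 hi).2 α).1
  rw [Fin.sum_univ_castSucc]
  have := (k (Fin.last N)).isLt
  have := s.isLt
  omega

/-- The linear map `φ : Sym^{N-1} E ⊗ ⋀^{N+1} Sym^{d+1} E → ⋀^N Sym^d E ⊗ Sym^d E` with
`φ(X^{N-1-s}Y^s ⊗ F_∧^{(d+1)}(k)) = ∑_{i ∈ B(k)} F(i, s + |k| - N - |i|)` for `0 ≤ s ≤ N - 1` and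
`k` strictly increasing. -/
def phi (N d : ℕ) (hN : 1 ≤ N) :
    SymPow F (N - 1) (E F) ⊗[F] (⋀[F]^(N + 1) (SymPow F (d + 1) (E F))) →ₗ[F]
      (⋀[F]^N (SymPow F d (E F))) ⊗[F] SymPow F d (E F) :=
  ((symBasis F (N - 1)).tensorProduct (wedgeBasis F (d + 1) (N + 1))).constr F fun p ↦
    ∑ i : box p.2, FElt F d N i.1
      ⟨p.1.val + (∑ α, (p.2 α).val) - N - ∑ α, (i.1 α).val, index_lt hN p.1 i.2⟩

lemma tensorBasis_apply (N d : ℕ) (s : Fin (N - 1 + 1)) (k : Fin (N + 1) ↪o Fin (d + 2)) :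
    (symBasis F (N - 1)).tensorProduct (wedgeBasis F (d + 1) (N + 1)) (s, k) =
      monomial F (N - 1) s ⊗ₜ wedge F (d + 1) (N + 1) k := by
  rw [Module.Basis.tensorProduct_apply, symBasis_apply, wedgeBasis_apply]

lemma phi_basis (N d : ℕ) (hN : 1 ≤ N) (s : Fin (N - 1 + 1)) (k : Fin (N + 1) ↪o Fin (d + 2)) :
    phi F N d hN ((symBasis F (N - 1)).tensorProduct (wedgeBasis F (d + 1) (N + 1)) (s, k)) =
      ∑ i : box k, FElt F d N i.1
        ⟨s.val + (∑ α, (k α).val) - N - ∑ α, (i.1 α).val, index_lt hN s i.2⟩ :=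
  Module.Basis.constr_basis _ _ _ _

lemma phi_apply (N d : ℕ) (hN : 1 ≤ N) (s : Fin (N - 1 + 1)) (k : Fin (N + 1) ↪o Fin (d + 2)) :
    phi F N d hN (monomial F (N - 1) s ⊗ₜ wedge F (d + 1) (N + 1) k) =
      ∑ i : box k, FElt F d N i.1
        ⟨s.val + (∑ α, (k α).val) - N - ∑ α, (i.1 α).val, index_lt hN s i.2⟩ := by
  rw [← tensorBasis_apply, phi_basis]

end Phi

end Plethysm

end

/-! The proof reads tensors as functions of points. Evaluating `f ⊗ x` in `Sym^{N-1} E ⊗ ⋀^{N+1}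
Sym^{d+1} E` at `(q; q, p_1, …, p_N)` gives `f(q) · x(q, p_1, …, p_N)`, where a wedge is evaluated
as a determinant. The key identity `evalExtTensor_phi` says that `φ` is division by brackets: `φ(f ⊗
x)(p_1, …, p_N; q) · ∏_β [p_β, q] = f(q) · x(q, p_1, …, p_N)`, where `[p, q] = p 1 * q 0 - q 1 * p
0`. To obtain it, clear the `q`-column of the determinant; each remaining entry is a difference of
two monomials, which is a bracket times a geometric sum over one side of the box.

Evaluation at generic points `(1, x_β)` over a rational function field is injective even when `F` is
finite, so every claim can be tested there: - equivariance (`phi_tprod`): brackets are invariant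
under `SL_2`; - image in `ker μ_N` (`phi_mem_Delta`): Laplace expansion turns `μ_N ∘ φ` into a
multiple of `∑_β τ_β^s / ∏_α (τ_β - τ_α)`, with `α` over the other indices, which vanishes for `s <
N` by Lagrange interpolation; - injectivity (`phi_injective`): the vanishing of `φ` gives a
Vandermonde system.

Surjectivity onto `ker μ_N` then follows by comparing dimensions. -/

noncomputable section

namespace Plethysm

/-! ### Determinants -/

section Det

variable {A : Type*} [CommRing A]

/-- Replacing each row after the first by a combination of itself and the previous row. -/
lemma det_cons_smul_sub_smul {N : ℕ} (M : Matrix (Fin (N + 1)) (Fin (N + 1)) A) (x y : Fin N → A) :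
    (Matrix.of (Fin.cons (M 0) fun α : Fin N ↦ x α • M α.succ - y α • M α.castSucc)).det =
      (∏ α, x α) * M.det := by
  let U : Matrix (Fin (N + 1)) (Fin (N + 1)) A := Matrix.of
    (Fin.cons (Pi.single 0 1) fun α : Fin N ↦ Pi.single α.succ (x α) - Pi.single α.castSucc (y α))
  have hU : U.det = ∏ α, x α := by
    rw [Matrix.det_of_isLowerTriangular]
    · simp only [Fin.prod_univ_succ, U, Matrix.of_apply, Fin.cons_zero, Pi.single_eq_same, one_mul,
        Fin.cons_succ, Pi.sub_apply]
      refine Finset.prod_congr rfl fun α _ ↦ ?_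
      rw [Pi.single_eq_of_ne (Fin.castSucc_lt_succ (i := α)).ne', sub_zero]
    · intro i j hij
      have hij : i < j := hij
      induction i using Fin.cases with
      | zero => simp [U, hij.ne']
      | succ α =>
        have h : α.castSucc < j := lt_trans Fin.castSucc_lt_succ hij
        simp [U, hij.ne', h.ne']
  rw [← hU, ← Matrix.det_mul]
  congr 1
  ext i j
  rw [Matrix.mul_apply_eq_vecMul]
  induction i using Fin.cases with
  | zero =>
    change M 0 j = Matrix.vecMul (Pi.single 0 1) M j
    simp
  | succ α =>
    change _ = Matrix.vecMul (Pi.single α.succ (x α) - Pi.single α.castSucc (y α)) M j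
    simp [Matrix.sub_vecMul]

/-- The hypothesis makes the row operations clear the first column below its top entry. Keeping `∏
α, x α` on the left avoids any division. -/
lemma prod_mul_det_eq {N : ℕ} (M : Matrix (Fin (N + 1)) (Fin (N + 1)) A) (x y : Fin N → A)
    (h : ∀ α, x α * M α.succ 0 = y α * M α.castSucc 0) :
    (∏ α, x α) * M.det = M 0 0 * (Matrix.of fun α β : Fin N ↦
      x α * M α.succ β.succ - y α * M α.castSucc β.succ).det := by
  rw [← det_cons_smul_sub_smul M x y, Matrix.det_succ_column_zero, Fin.sum_univ_succ,
    Finset.sum_eq_zero fun α _ ↦ by simp [h]]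
  simp only [Fin.val_zero, pow_zero, one_mul, Matrix.of_apply, Fin.cons_zero, add_zero]
  congr 2

end Det

/-! ### Evaluation of forms at points -/

section Eval

variable {F : Type*} [Field F] {K : Type*} [Field K] [Algebra F K]

/-- Evaluation of polynomials in `X` and `Y` at the point `(p 0, p 1)`. -/
def evalAlg (p : Fin 2 → K) : SymmetricAlgebra F (E F) →ₐ[F] K :=
  SymmetricAlgebra.lift (Fintype.linearCombination F p)

lemma evalAlg_ι (p : Fin 2 → K) (v : E F) :
    evalAlg p (SymmetricAlgebra.ι F (E F) v) = v 0 • p 0 + v 1 • p 1 := by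
  simp [evalAlg, Fintype.linearCombination_apply]

/-- Evaluation of binary forms of degree `c` at a point. -/
def evalSym (c : ℕ) (p : Fin 2 → K) : SymPow F c (E F) →ₗ[F] K :=
  (evalAlg p).toLinearMap ∘ₗ (SymPow F c (E F)).subtype

lemma evalSym_monomial (c : ℕ) (p : Fin 2 → K) (i : Fin (c + 1)) :
    evalSym c p (monomial F c i) = p 0 ^ (c - i.val) * p 1 ^ i.val := by
  simp [evalSym, monomial, X, Y, evalAlg_ι]

/-- The action of `SL_2(F)` on points adjoint to its action on binary forms. -/
def actPoint (g : Matrix.SpecialLinearGroup (Fin 2) F) (p : Fin 2 → K) : Fin 2 → K :=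
  fun j ↦ g.1 0 j • p 0 + g.1 1 j • p 1

lemma evalSym_symRep (c : ℕ) (g : Matrix.SpecialLinearGroup (Fin 2) F) (p : Fin 2 → K) :
    evalSym c p ∘ₗ symRep c (natRep F) g = evalSym c (actPoint g p) := by
  have h : (evalAlg p).comp (symAlgMap (natRep F g)) = evalAlg (F := F) (actPoint g p) := by
    refine SymmetricAlgebra.algHom_ext (LinearMap.ext fun v ↦ ?_)
    change evalAlg p (symAlgMap (natRep F g) (SymmetricAlgebra.ι F (E F) v)) =
      evalAlg (actPoint g p) (SymmetricAlgebra.ι F (E F) v)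
    rw [symAlgMap_ι, evalAlg_ι, evalAlg_ι]
    simp only [natRep, MonoidHom.coe_mk, OneHom.coe_mk, Matrix.toLin'_apply, Matrix.mulVec,
      dotProduct, Fin.sum_univ_two, actPoint, add_smul, smul_add, smul_smul]
    simp only [mul_comm]
    abel
  exact LinearMap.ext fun v ↦ DFunLike.congr_fun h v.1

/-- The linear form on `⋀^r Sym^c E` with value `det (v_α(p_β))` at `v_1 ∧ ⋯ ∧ v_r`. -/
def detForm (c : ℕ) {r : ℕ} (p : Fin r → Fin 2 → K) : ⋀[F]^r (SymPow F c (E F)) →ₗ[F] K :=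
  exteriorPower.alternatingMapLinearEquiv
    -- The determinant is alternating over `K`, whereas the forms are an `F`-space, so scalars are
    -- restricted.
    (({ Matrix.detRowAlternating.toMultilinearMap.restrictScalars F with
        map_eq_zero_of_eq' := fun v _ _ h hij ↦
          (Matrix.detRowAlternating (R := K)).map_eq_zero_of_eq v h hij } :
      (Fin r → K) [⋀^Fin r]→ₗ[F] K).compLinearMap (LinearMap.pi fun β ↦ evalSym c (p β)))

lemma detForm_ιMulti (c : ℕ) {r : ℕ} (p : Fin r → Fin 2 → K) (v : Fin r → SymPow F c (E F)) :
    detForm c p (exteriorPower.ιMulti F r v) =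
      (Matrix.of fun α β ↦ evalSym c (p β) (v α)).det := by
  rw [detForm, exteriorPower.alternatingMapLinearEquiv_apply_ιMulti]
  rfl

lemma detForm_extRep (c : ℕ) {r : ℕ} (g : Matrix.SpecialLinearGroup (Fin 2) F)
    (p : Fin r → Fin 2 → K) :
    detForm c p ∘ₗ extRep r (symRep c (natRep F)) g =
      detForm (F := F) c (fun β ↦ actPoint g (p β)) := by
  ext v
  simp [extRep, detForm_ιMulti, ← evalSym_symRep]

lemma detForm_comp_perm (c : ℕ) {r : ℕ} (p : Fin r → Fin 2 → K) (σ : Equiv.Perm (Fin r))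
    (x : ⋀[F]^r (SymPow F c (E F))) :
    detForm c (p ∘ σ) x = (Equiv.Perm.sign σ : ℤ) * detForm c p x := by
  have h : detForm (F := F) c (p ∘ σ) =
      LinearMap.mulLeft F ((Equiv.Perm.sign σ : ℤ) : K) ∘ₗ detForm c p := by
    ext v
    simp only [LinearMap.compAlternatingMap_apply, LinearMap.comp_apply, detForm_ιMulti,
      LinearMap.mulLeft_apply]
    exact Matrix.det_permute' σ (Matrix.of fun α β ↦ evalSym c (p β) (v α))
  exact LinearMap.congr_fun h x

/-- Evaluation of `⋀^N Sym^d E ⊗ Sym^d E` at `N + 1` points. -/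
def evalExtTensor (d : ℕ) {N : ℕ} (p : Fin N → Fin 2 → K) (q : Fin 2 → K) :
    (⋀[F]^N (SymPow F d (E F))) ⊗[F] SymPow F d (E F) →ₗ[F] K :=
  LinearMap.mul' F K ∘ₗ TensorProduct.map (detForm d p) (evalSym d q)

/-- Evaluation of `Sym^c E ⊗ ⋀^r Sym^d E` at `1 + r` points. -/
def evalTensorExt (c d : ℕ) {r : ℕ} (q : Fin 2 → K) (p : Fin r → Fin 2 → K) :
    SymPow F c (E F) ⊗[F] (⋀[F]^r (SymPow F d (E F))) →ₗ[F] K :=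
  LinearMap.mul' F K ∘ₗ TensorProduct.map (evalSym c q) (detForm d p)

lemma evalExtTensor_tmul (d : ℕ) {N : ℕ} (p : Fin N → Fin 2 → K) (q : Fin 2 → K)
    (x : ⋀[F]^N (SymPow F d (E F))) (w : SymPow F d (E F)) :
    evalExtTensor d p q (x ⊗ₜ w) = detForm d p x * evalSym d q w := by
  simp [evalExtTensor]

lemma evalTensorExt_tmul (c d : ℕ) {r : ℕ} (q : Fin 2 → K) (p : Fin r → Fin 2 → K)
    (f : SymPow F c (E F)) (x : ⋀[F]^r (SymPow F d (E F))) :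
    evalTensorExt c d q p (f ⊗ₜ x) = evalSym c q f * detForm d p x := by
  simp [evalTensorExt]

lemma mul'_map_tprod {G V W : Type*} [Monoid G] [AddCommMonoid V] [Module F V] [AddCommMonoid W]
    [Module F W] (ρ : Representation F G V) (σ : Representation F G W) {g : G} {a a' : V →ₗ[F] K}
    {b b' : W →ₗ[F] K} (ha : a ∘ₗ ρ g = a') (hb : b ∘ₗ σ g = b') (t : V ⊗[F] W) :
    (LinearMap.mul' F K ∘ₗ TensorProduct.map a b) ((ρ.tprod σ) g t) =
      (LinearMap.mul' F K ∘ₗ TensorProduct.map a' b') t := by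
  rw [← ha, ← hb, TensorProduct.map_comp]
  rfl

lemma evalExtTensor_tprod (d : ℕ) {N : ℕ} (g : Matrix.SpecialLinearGroup (Fin 2) F)
    (p : Fin N → Fin 2 → K) (q : Fin 2 → K)
    (t : (⋀[F]^N (SymPow F d (E F))) ⊗[F] SymPow F d (E F)) :
    evalExtTensor d p q
        (((extRep N (symRep d (natRep F))).tprod (symRep d (natRep F))) g t) =
      evalExtTensor d (fun β ↦ actPoint g (p β)) (actPoint g q) t :=
  mul'_map_tprod _ _ (detForm_extRep (F := F) d g p) (evalSym_symRep (F := F) d g q) t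

lemma evalTensorExt_tprod (c d : ℕ) {r : ℕ} (g : Matrix.SpecialLinearGroup (Fin 2) F)
    (q : Fin 2 → K) (p : Fin r → Fin 2 → K)
    (t : SymPow F c (E F) ⊗[F] (⋀[F]^r (SymPow F d (E F)))) :
    evalTensorExt c d q p
        (((symRep c (natRep F)).tprod (extRep r (symRep d (natRep F)))) g t) =
      evalTensorExt c d (actPoint g q) (fun β ↦ actPoint g (p β)) t :=
  mul'_map_tprod _ _ (evalSym_symRep (F := F) c g q) (detForm_extRep (F := F) d g p) t

end Eval

/-! ### Evaluation of `φ` -/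

section EvalPhi

lemma sum_filter_fin_eq_sum_Ico {A : Type*} [AddCommMonoid A] {n a b : ℕ} (hb : b ≤ n)
    (h : ℕ → A) :
    ∑ i : Fin n with a ≤ i.val ∧ i.val < b, h i.val = ∑ i ∈ Finset.Ico a b, h i := by
  refine Finset.sum_nbij Fin.val (fun i hi ↦ by simpa using hi) (fun i _ j _ ↦ Fin.ext)
    (fun i hi ↦ ?_) fun _ _ ↦ rfl
  have hi' := Finset.mem_Ico.1 (Finset.mem_coe.1 hi)
  exact ⟨⟨i, by omega⟩, by simpa using hi', rfl⟩

/-- Multiplying by the bracket makes the sum telescope along `u^(i-a) v^(b-i) x^(d+1-i) y^i`. -/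
lemma sum_Ico_mul_sub {A : Type*} [CommRing A] {d a b : ℕ} (hab : a ≤ b) (hb : b ≤ d + 1)
    (x y u v : A) :
    (∑ i ∈ Finset.Ico a b, u ^ (i - a) * v ^ (b - 1 - i) * (x ^ (d - i) * y ^ i)) *
        (y * u - v * x) =
      u ^ (b - a) * (x ^ (d + 1 - b) * y ^ b) - v ^ (b - a) * (x ^ (d + 1 - a) * y ^ a) := by
  have h := Finset.sum_Ico_sub
    (fun i ↦ u ^ (i - a) * v ^ (b - i) * (x ^ (d + 1 - i) * y ^ i)) hab
  simp only [Nat.sub_self, pow_zero, mul_one, one_mul] at h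
  rw [← h, Finset.sum_mul]
  refine Finset.sum_congr rfl fun i hi ↦ ?_
  obtain ⟨h₁, h₂⟩ := Finset.mem_Ico.1 hi
  rw [show i + 1 - a = (i - a) + 1 by omega, show b - (i + 1) = b - 1 - i by omega,
    show b - i = (b - 1 - i) + 1 by omega, show d + 1 - (i + 1) = d - i by omega,
    show d + 1 - i = (d - i) + 1 by omega]
  ring

lemma box_eq_piFinset {d N : ℕ} (k : Fin (N + 1) ↪o Fin (d + 2)) :
    box k = Fintype.piFinset fun α : Fin N ↦
      {i : Fin (d + 1) | (k α.castSucc).val ≤ i.val ∧ i.val < (k α.succ).val} := by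
  ext i
  simp [box]

/-- The monomial in the last tensor factor of `φ` splits as a product over the sides of the box. -/
lemma pow_mul_pow_index {A : Type*} [CommRing A] {d N : ℕ} (hN : 1 ≤ N) (s : Fin (N - 1 + 1))
    {k : Fin (N + 1) ↪o Fin (d + 2)} {i : Fin N → Fin (d + 1)} (hi : i ∈ box k) (u v : A) :
    u ^ (d - (s.val + (∑ α, (k α).val) - N - ∑ α, (i α).val)) *
        v ^ (s.val + (∑ α, (k α).val) - N - ∑ α, (i α).val) =
      u ^ (N - 1 - s.val) * v ^ s.val * (u ^ (d + 1 - (k (Fin.last N)).val) * v ^ (k 0).val) *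
        ∏ α, (u ^ ((i α).val - (k α.castSucc).val) * v ^ ((k α.succ).val - 1 - (i α).val)) := by
  have hi' := (Finset.mem_filter.1 hi).2
  have h₁ : ∑ α : Fin N, ((i α).val - (k α.castSucc).val) + ∑ α : Fin N, (k α.castSucc).val =
      ∑ α, (i α).val := by
    rw [← Finset.sum_add_distrib]
    exact Finset.sum_congr rfl fun α _ ↦ by have := hi' α; omega
  have h₂ : ∑ α : Fin N, ((k α.succ).val - 1 - (i α).val) + ∑ α, (i α).val + N =
      ∑ α : Fin N, (k α.succ).val := by
    have h : ∑ α : Fin N, 1 = N := by simp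
    refine (congrArg _ h.symm).trans ?_
    rw [← Finset.sum_add_distrib, ← Finset.sum_add_distrib]
    exact Finset.sum_congr rfl fun α _ ↦ by have := hi' α; omega
  have h₃ := Fin.sum_univ_castSucc fun α ↦ (k α).val
  have h₄ := Fin.sum_univ_succ fun α ↦ (k α).val
  have h₅ := index_lt hN s hi
  have h₆ := s.isLt
  have h₇ := (k (Fin.last N)).isLt
  -- Splitting `|k|` at its first or last entry shows that both exponents are sums of untruncated
  -- differences along the sides of the box, plus boundary terms.
  rw [Finset.prod_mul_distrib, Finset.prod_pow_eq_pow_sum, Finset.prod_pow_eq_pow_sum,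
    show s.val + (∑ α, (k α).val) - N - ∑ α, (i α).val =
      s.val + (k 0).val + ∑ α : Fin N, ((k α.succ).val - 1 - (i α).val) by omega,
    show d - (s.val + (k 0).val + ∑ α : Fin N, ((k α.succ).val - 1 - (i α).val)) =
      (N - 1 - s.val) + (d + 1 - (k (Fin.last N)).val) +
        ∑ α : Fin N, ((i α).val - (k α.castSucc).val) by omega]
  simp only [pow_add]
  ring

variable {F : Type*} [Field F] {K : Type*} [Field K] [Algebra F K]

/-- For `m_α = X^{d+1-k_α}Y^{k_α}`, the determinant `det (m_α(p_β))` with points `q, p_1, …, p_N`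
as an `N × N` determinant. -/
lemma det_monomials_cons {d N : ℕ} (k : Fin (N + 1) ↪o Fin (d + 2)) (p : Fin N → Fin 2 → K)
    (q : Fin 2 → K) (hq : q 0 ≠ 0) :
    (Matrix.of fun α β : Fin (N + 1) ↦
        (Fin.cons q p : Fin (N + 1) → Fin 2 → K) β 0 ^ (d + 1 - (k α).val) *
          (Fin.cons q p : Fin (N + 1) → Fin 2 → K) β 1 ^ (k α).val).det =
      q 0 ^ (d + 1 - (k (Fin.last N)).val) * q 1 ^ (k 0).val * (Matrix.of fun α β : Fin N ↦
        q 0 ^ ((k α.succ).val - (k α.castSucc).val) *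
          (p β 0 ^ (d + 1 - (k α.succ).val) * p β 1 ^ (k α.succ).val) -
        q 1 ^ ((k α.succ).val - (k α.castSucc).val) *
          (p β 0 ^ (d + 1 - (k α.castSucc).val) * p β 1 ^ (k α.castSucc).val)).det := by
  have hk : ∀ α : Fin N, (k α.castSucc).val < (k α.succ).val := fun α ↦
    k.strictMono Fin.castSucc_lt_succ
  have hd : ∀ α, (k α).val < d + 2 := fun α ↦ (k α).isLt
  have hkl : (k 0).val ≤ (k (Fin.last N)).val := k.monotone (Fin.zero_le _)
  -- With `δ = k_{α+1} - k_α`, one has `q 0 ^ δ * m_{α+1}(q) = q 1 ^ δ * m_α(q)`, so these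
  -- multipliers clear the column of `q`.
  have h := prod_mul_det_eq (Matrix.of fun α β : Fin (N + 1) ↦
      (Fin.cons q p : Fin (N + 1) → Fin 2 → K) β 0 ^ (d + 1 - (k α).val) *
        (Fin.cons q p : Fin (N + 1) → Fin 2 → K) β 1 ^ (k α).val)
    (fun α ↦ q 0 ^ ((k α.succ).val - (k α.castSucc).val))
    (fun α ↦ q 1 ^ ((k α.succ).val - (k α.castSucc).val)) fun α ↦ by
      have h₁ := hk α
      have h₂ := hd α.succ
      simp only [Matrix.of_apply, Fin.cons_zero]
      rw [← mul_assoc, ← pow_add, mul_left_comm, ← pow_add]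
      congr 2 <;> omega
  have hsum : ∑ α : Fin N, ((k α.succ).val - (k α.castSucc).val) =
      (k (Fin.last N)).val - (k 0).val := by
    have h₁ : ∑ α : Fin N, ((k α.succ).val - (k α.castSucc).val) + ∑ α : Fin N, (k α.castSucc).val =
        ∑ α : Fin N, (k α.succ).val := by
      rw [← Finset.sum_add_distrib]
      exact Finset.sum_congr rfl fun α _ ↦ by have := hk α; omega
    have h₃ := Fin.sum_univ_castSucc fun α ↦ (k α).val
    have h₄ := Fin.sum_univ_succ fun α ↦ (k α).val
    omega
  rw [Finset.prod_pow_eq_pow_sum, hsum] at h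
  -- The row multipliers have telescoped to one power of `q 0`, which divides the corner entry
  -- `m_0(q)`; cancelling it is where `q 0 ≠ 0` is needed.
  refine mul_left_cancel₀ (pow_ne_zero ((k (Fin.last N)).val - (k 0).val) hq) (h.trans ?_)
  simp only [Matrix.of_apply, Fin.cons_zero, Fin.cons_succ]
  rw [← mul_assoc, ← mul_assoc, ← pow_add]
  congr 3
  have := hd (Fin.last N)
  omega

lemma evalExtTensor_FElt {N d : ℕ} (hN : 1 ≤ N) (p : Fin N → Fin 2 → K) (q : Fin 2 → K)
    (s : Fin (N - 1 + 1)) (k : Fin (N + 1) ↪o Fin (d + 2)) (i : box k) :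
    evalExtTensor d p q (FElt F d N i.1
        ⟨s.val + (∑ α, (k α).val) - N - ∑ α, (i.1 α).val, index_lt hN s i.2⟩) =
      q 0 ^ (N - 1 - s.val) * q 1 ^ s.val *
        (q 0 ^ (d + 1 - (k (Fin.last N)).val) * q 1 ^ (k 0).val) *
        (Matrix.of fun α β : Fin N ↦
          q 0 ^ ((i.1 α).val - (k α.castSucc).val) * q 1 ^ ((k α.succ).val - 1 - (i.1 α).val) *
            (p β 0 ^ (d - (i.1 α).val) * p β 1 ^ (i.1 α).val)).det := by
  rw [FElt, evalExtTensor_tmul, evalSym_monomial, wedge, detForm_ιMulti,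
    pow_mul_pow_index hN s i.2, mul_left_comm,
    mul_comm (Matrix.det _) (Finset.prod _ _), ← Matrix.det_mul_column]
  simp only [evalSym_monomial, Matrix.of_apply]

/-- The box is a product of intervals and row `α` depends only on `i α`, so multilinearity in the
rows moves the sum inside. -/
lemma sum_box_det {N d : ℕ} (p : Fin N → Fin 2 → K) (q : Fin 2 → K)
    (k : Fin (N + 1) ↪o Fin (d + 2)) :
    ∑ i : box k, (Matrix.of fun α β : Fin N ↦
          q 0 ^ ((i.1 α).val - (k α.castSucc).val) * q 1 ^ ((k α.succ).val - 1 - (i.1 α).val) *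
            (p β 0 ^ (d - (i.1 α).val) * p β 1 ^ (i.1 α).val)).det =
      (Matrix.of fun α β : Fin N ↦ ∑ i ∈ Finset.Ico (k α.castSucc).val (k α.succ).val,
          q 0 ^ (i - (k α.castSucc).val) * q 1 ^ ((k α.succ).val - 1 - i) *
            (p β 0 ^ (d - i) * p β 1 ^ i)).det := by
  rw [Finset.sum_coe_sort (box k) fun i ↦ (Matrix.of fun α β : Fin N ↦
        q 0 ^ ((i α).val - (k α.castSucc).val) * q 1 ^ ((k α.succ).val - 1 - (i α).val) *
          (p β 0 ^ (d - (i α).val) * p β 1 ^ (i α).val)).det, box_eq_piFinset]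
  refine ((Matrix.detRowAlternating (n := Fin N) (R := K)).toMultilinearMap.map_sum_finset
    (fun α i β ↦ q 0 ^ (i.val - (k α.castSucc).val) * q 1 ^ ((k α.succ).val - 1 - i.val) *
          (p β 0 ^ (d - i.val) * p β 1 ^ i.val)) (fun α : Fin N ↦
    {i : Fin (d + 1) | (k α.castSucc).val ≤ i.val ∧ i.val < (k α.succ).val})).symm.trans ?_
  refine congrArg Matrix.det (Matrix.ext fun α β ↦ ?_)
  refine (Finset.sum_apply _ _ _).trans (sum_filter_fin_eq_sum_Ico
    (Nat.lt_succ_iff.1 (k α.succ).isLt) fun i ↦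
      q 0 ^ (i - (k α.castSucc).val) * q 1 ^ ((k α.succ).val - 1 - i) *
          (p β 0 ^ (d - i) * p β 1 ^ i))

/-- After `det_monomials_cons`, every entry of column `β` is divisible by the bracket of `p β` and
`q`, by `sum_Ico_mul_sub`; the brackets come out column by column. -/
lemma detForm_wedge_cons {N d : ℕ} (p : Fin N → Fin 2 → K) (q : Fin 2 → K)
    (hq : q 0 ≠ 0) (k : Fin (N + 1) ↪o Fin (d + 2)) :
    detForm (d + 1) (Fin.cons q p : Fin (N + 1) → Fin 2 → K) (wedge F (d + 1) (N + 1) k) =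
      q 0 ^ (d + 1 - (k (Fin.last N)).val) * q 1 ^ (k 0).val *
        ((Matrix.of fun α β : Fin N ↦ ∑ i ∈ Finset.Ico (k α.castSucc).val (k α.succ).val,
          q 0 ^ (i - (k α.castSucc).val) * q 1 ^ ((k α.succ).val - 1 - i) *
            (p β 0 ^ (d - i) * p β 1 ^ i)).det * ∏ β, (p β 1 * q 0 - q 1 * p β 0)) := by
  rw [wedge, detForm_ιMulti]
  simp only [evalSym_monomial]
  rw [det_monomials_cons k p q hq, mul_comm (Matrix.det _) (Finset.prod _ _),
    ← Matrix.det_mul_row]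
  simp only [Matrix.of_apply]
  congr 2
  refine Matrix.ext fun α β ↦ ?_
  rw [Matrix.of_apply, Matrix.of_apply, mul_comm (_ - _)]
  exact (sum_Ico_mul_sub (k.strictMono Fin.castSucc_lt_succ).le
    (Nat.lt_succ_iff.1 (k α.succ).isLt) _ _ _ _).symm

lemma evalExtTensor_phi_tmul {N d : ℕ} (hN : 1 ≤ N) (p : Fin N → Fin 2 → K) (q : Fin 2 → K)
    (hq : q 0 ≠ 0) (s : Fin (N - 1 + 1)) (k : Fin (N + 1) ↪o Fin (d + 2)) :
    evalExtTensor d p q (phi F N d hN (monomial F (N - 1) s ⊗ₜ wedge F (d + 1) (N + 1) k)) *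
        ∏ β, (p β 1 * q 0 - q 1 * p β 0) =
      evalTensorExt (N - 1) (d + 1) q (Fin.cons q p : Fin (N + 1) → Fin 2 → K)
        (monomial F (N - 1) s ⊗ₜ wedge F (d + 1) (N + 1) k) := by
  have hphi := (congrArg (evalExtTensor (F := F) d p q) (phi_apply F N d hN s k)).trans
    ((map_sum (evalExtTensor (F := F) d p q) _ _).trans
      ((Finset.sum_congr rfl fun i _ ↦ evalExtTensor_FElt hN p q s k i).trans
        ((Finset.mul_sum _ _ _).symm.trans (congrArg _ (sum_box_det p q k)))))
  refine (congrArg (· * ∏ β, (p β 1 * q 0 - q 1 * p β 0)) hphi).trans (Eq.trans ?_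
    ((evalTensorExt_tmul (N - 1) (d + 1) q (Fin.cons q p : Fin (N + 1) → Fin 2 → K) _ _).trans
      (congrArg₂ (· * ·) (evalSym_monomial (F := F) (N - 1) q s)
        (detForm_wedge_cons (F := F) p q hq k))).symm)
  ring

/-- The key identity: on functions of points, `φ` repeats the point `q` and divides by the brackets.
It replaces the sum over boxes in all that follows. -/
lemma evalExtTensor_phi {N d : ℕ} (hN : 1 ≤ N) (p : Fin N → Fin 2 → K) (q : Fin 2 → K)
    (hq : q 0 ≠ 0) (t : SymPow F (N - 1) (E F) ⊗[F] (⋀[F]^(N + 1) (SymPow F (d + 1) (E F)))) :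
    evalExtTensor d p q (phi F N d hN t) * ∏ β, (p β 1 * q 0 - q 1 * p β 0) =
      evalTensorExt (N - 1) (d + 1) q (Fin.cons q p : Fin (N + 1) → Fin 2 → K) t := by
  have h : LinearMap.mulRight F (∏ β, (p β 1 * q 0 - q 1 * p β 0)) ∘ₗ evalExtTensor d p q ∘ₗ
      phi F N d hN =
        evalTensorExt (N - 1) (d + 1) q (Fin.cons q p : Fin (N + 1) → Fin 2 → K) := by
    refine ((symBasis F (N - 1)).tensorProduct (wedgeBasis F (d + 1) (N + 1))).ext fun ⟨s, k⟩ ↦ ?_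
    have hb := tensorBasis_apply F N d s k
    exact (congrArg _ hb).trans ((evalExtTensor_phi_tmul hN p q hq s k).trans (congrArg _ hb.symm))
  exact LinearMap.congr_fun h t

end EvalPhi

/-! ### Generic points -/

section Generic

/-- The functionals `c i` on `R` recover the coordinates of a vector from its image, which already
lies in `R ⊆ K`. -/
lemma injective_of_basis_dual {F V R K ι : Type*} [Field F] [AddCommMonoid V] [Module F V]
    [CommRing R] [Algebra F R] [Field K] [Algebra F K] [Algebra R K] [IsScalarTower F R K]
    [IsFractionRing R K] [DecidableEq ι] (b : Module.Basis ι F V) (f : V →ₗ[F] K) (P : ι → R)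
    (hf : ∀ i, f (b i) = algebraMap R K (P i)) (c : ι → R →ₗ[F] F)
    (hc : ∀ i j, c i (P j) = if j = i then 1 else 0) : Function.Injective f := by
  let g : V →ₗ[F] R := b.constr F P
  have hg : (IsScalarTower.toAlgHom F R K).toLinearMap ∘ₗ g = f := b.ext fun i ↦ by
    simp [g, hf, b.constr_basis]
  have hcg : ∀ i, c i ∘ₗ g = b.coord i := fun i ↦ b.ext fun j ↦ by
    simp [g, hc, b.constr_basis, Finsupp.single_apply]
  rw [← hg]
  refine (IsFractionRing.injective R K).comp fun x y hxy ↦ b.ext_elem fun i ↦ ?_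
  rw [← b.coord_apply, ← b.coord_apply, ← hcg, LinearMap.comp_apply, hxy, LinearMap.comp_apply]

open MvPolynomial in
/-- For strictly increasing multi-indices, the coefficient of the diagonal monomial attached to one
of them, times a power of the first variable, in the generic alternant attached to the other. -/
lemma coeff_det_mul_X_pow {F : Type*} [Field F] {N m : ℕ} (k k' : Fin N ↪o Fin m) (j j' : ℕ) :
    coeff (Finsupp.equivFunOnFinite.symm (Fin.cons j' fun α ↦ (k' α).val : Fin (N + 1) → ℕ))
        ((Matrix.of fun α β : Fin N ↦
          (MvPolynomial.X β.succ : MvPolynomial (Fin (N + 1)) F) ^ (k α).val).det *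
            MvPolynomial.X 0 ^ j) = if k = k' ∧ j = j' then 1 else 0 := by
  have hmon : ∀ e : Fin (N + 1) → ℕ, (MvPolynomial.X 0 : MvPolynomial (Fin (N + 1)) F) ^ e 0 *
      ∏ β : Fin N, MvPolynomial.X β.succ ^ e β.succ =
        MvPolynomial.monomial (Finsupp.equivFunOnFinite.symm e) 1 := by
    intro e
    rw [MvPolynomial.monomial_eq, Finsupp.prod_fintype _ _ (by simp), Fin.prod_univ_succ]
    simp
  have hterm : ∀ σ : Equiv.Perm (Fin N), coeff
      (Finsupp.equivFunOnFinite.symm (Fin.cons j' fun α ↦ (k' α).val : Fin (N + 1) → ℕ))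
      ((∏ β : Fin N, (MvPolynomial.X β.succ : MvPolynomial (Fin (N + 1)) F) ^ (k (σ β)).val) *
        MvPolynomial.X 0 ^ j) = if σ = 1 ∧ k = k' ∧ j = j' then 1 else 0 := by
    intro σ
    have h := hmon (Fin.cons j fun β ↦ (k (σ β)).val)
    simp only [Fin.cons_zero, Fin.cons_succ] at h
    rw [mul_comm, h, MvPolynomial.coeff_monomial]
    refine if_congr ?_ rfl rfl
    rw [Equiv.apply_eq_iff_eq, Fin.cons_inj]
    constructor
    · rintro ⟨h₁, h₂⟩
      have h₃ : k ∘ σ = k' := funext fun β ↦ Fin.ext (congrFun h₂ β)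
      -- A strictly increasing map is determined by its range, which permuting the arguments does
      -- not change; this forces `σ = 1`.
      have h₄ : (k : Fin N → Fin m) = k' := by
        rw [← StrictMono.range_inj k.strictMono k'.strictMono, ← h₃, Set.range_comp,
          σ.surjective.range_eq, Set.image_univ]
      refine ⟨Equiv.ext fun β ↦ k.injective ?_, DFunLike.coe_injective h₄, h₁⟩
      exact (congrFun h₃ β).trans (congrFun h₄.symm β)
    · rintro ⟨rfl, rfl, rfl⟩
      simp
  rw [Matrix.det_apply, Finset.sum_mul, MvPolynomial.coeff_sum]
  simp only [Matrix.of_apply, smul_mul_assoc, Units.smul_def, MvPolynomial.coeff_smul, hterm]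
  rw [Finset.sum_eq_single 1 (fun σ _ hσ ↦ by simp [hσ]) (by simp)]
  simp

variable (F : Type*) [Field F]

/-- The generic points `(1, x_0), …, (1, x_{n-1})`. -/
def genericPoint {n : ℕ} (β : Fin n) : Fin 2 → FractionRing (MvPolynomial (Fin n) F) :=
  ![1, algebraMap (MvPolynomial (Fin n) F) _ (MvPolynomial.X β)]

lemma genericPoint_zero {n : ℕ} (β : Fin n) : genericPoint F β 0 = 1 := rfl

lemma genericPoint_one_injective {n : ℕ} :
    Function.Injective fun β : Fin n ↦ genericPoint F β 1 := fun _ _ h ↦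
  MvPolynomial.X_injective (R := F)
    (IsFractionRing.injective _ (FractionRing (MvPolynomial (Fin n) F)) h)

lemma detForm_genericPoint_wedge (d N : ℕ) (k : Fin N → Fin (d + 1)) :
    detForm d (fun β : Fin N ↦ genericPoint F β.succ) (wedge F d N k) =
      algebraMap _ _ (Matrix.of fun α β : Fin N ↦
        (MvPolynomial.X β.succ : MvPolynomial (Fin (N + 1)) F) ^ (k α).val).det := by
  rw [wedge, detForm_ιMulti, RingHom.map_det]
  congr 1
  refine Matrix.ext fun α β ↦ ?_
  simp [evalSym_monomial, genericPoint]

lemma extTensorBasis_apply (d N : ℕ) (k : Fin N ↪o Fin (d + 1)) (j : Fin (d + 1)) :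
    (wedgeBasis F d N).tensorProduct (symBasis F d) (k, j) = FElt F d N k j := by
  rw [Module.Basis.tensorProduct_apply, symBasis_apply, wedgeBasis_apply, FElt]

lemma evalExtTensor_genericPoint_injective (d N : ℕ) :
    Function.Injective (evalExtTensor (F := F) d (fun β : Fin N ↦ genericPoint F β.succ)
      (genericPoint F 0)) := by
  classical
  refine injective_of_basis_dual ((wedgeBasis F d N).tensorProduct (symBasis F d)) _
    (fun i ↦ (Matrix.of fun α β : Fin N ↦
      (MvPolynomial.X β.succ : MvPolynomial (Fin (N + 1)) F) ^ (i.1 α).val).det *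
        MvPolynomial.X 0 ^ i.2.val) (fun i ↦ ?_)
    (fun i ↦ MvPolynomial.lcoeff F (Finsupp.equivFunOnFinite.symm
      (Fin.cons i.2.val fun α ↦ (i.1 α).val : Fin (N + 1) → ℕ))) fun i j ↦ ?_
  · obtain ⟨k, j⟩ := i
    refine (congrArg _ (extTensorBasis_apply F d N k j)).trans
      ((evalExtTensor_tmul _ _ _ _ _).trans ?_)
    rw [map_mul, detForm_genericPoint_wedge, evalSym_monomial]
    simp [genericPoint]
  · refine (coeff_det_mul_X_pow _ _ _ _).trans (if_congr ?_ rfl rfl)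
    rw [Prod.ext_iff, Fin.val_inj]

/-- The variable `x_0`, otherwise the point `q`, is left idle so that `coeff_det_mul_X_pow` applies
with both exponents `0`. -/
lemma detForm_genericPoint_injective (d N : ℕ) :
    Function.Injective (detForm (F := F) d (fun β : Fin N ↦ genericPoint F β.succ)) := by
  classical
  refine injective_of_basis_dual (wedgeBasis F d N) _
    (fun k ↦ (Matrix.of fun α β : Fin N ↦
      (MvPolynomial.X β.succ : MvPolynomial (Fin (N + 1)) F) ^ (k α).val).det) (fun k ↦ ?_)
    (fun k ↦ MvPolynomial.lcoeff F (Finsupp.equivFunOnFinite.symm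
      (Fin.cons 0 fun α ↦ (k α).val : Fin (N + 1) → ℕ))) fun k k' ↦ ?_
  · rw [wedgeBasis_apply, detForm_genericPoint_wedge]
  · have h := coeff_det_mul_X_pow (F := F) k' k 0 0
    rw [pow_zero, mul_one] at h
    simpa using h

end Generic

/-! ### The image of `φ` lies in the kernel of multiplication -/

section Kernel

lemma mu_ιMulti_tmul {F V : Type*} [Field F] [AddCommGroup V] [Module F V] (N : ℕ)
    (v : Fin N → V) (w : V) :
    mu F N V (exteriorPower.ιMulti F N v ⊗ₜ w) =
      exteriorPower.ιMulti F (N + 1) (Fin.snoc v w : Fin (N + 1) → V) := by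
  refine Subtype.ext ?_
  rw [mu_tmul, exteriorPower.ιMulti_apply_coe, exteriorPower.ιMulti_apply_coe,
    ExteriorAlgebra.ιMulti_apply, ExteriorAlgebra.ιMulti_apply, List.ofFn_succ',
    List.concat_eq_append, List.prod_append]
  simp

lemma mu_surjective (F : Type*) [Field F] (N : ℕ) (V : Type*) [AddCommGroup V] [Module F V] :
    Function.Surjective (mu F N V) := by
  rw [← LinearMap.range_eq_top, eq_top_iff, ← exteriorPower.ιMulti_span, Submodule.span_le]
  rintro _ ⟨v, rfl⟩
  refine ⟨exteriorPower.ιMulti F N (fun α ↦ v α.castSucc) ⊗ₜ v (Fin.last N), ?_⟩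
  rw [mu_ιMulti_tmul]
  congr 1
  exact Fin.snoc_init_self v

variable {F : Type*} [Field F] {K : Type*} [Field K] [Algebra F K]

/-- Laplace expansion along the last row, the one belonging to `w`. -/
lemma detForm_ιMulti_snoc {d N : ℕ} (p : Fin (N + 1) → Fin 2 → K)
    (v : Fin N → SymPow F d (E F)) (w : SymPow F d (E F)) :
    detForm d p (exteriorPower.ιMulti F (N + 1) (Fin.snoc v w : Fin (N + 1) → _)) =
      ∑ β : Fin (N + 1), (-1) ^ (N + β.val) * evalSym d (p β) w *
        detForm d (fun α ↦ p (β.succAbove α)) (exteriorPower.ιMulti F N v) := by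
  rw [detForm_ιMulti, Matrix.det_succ_row _ (Fin.last N)]
  refine Finset.sum_congr rfl fun β _ ↦ ?_
  rw [detForm_ιMulti, Matrix.of_apply, Fin.snoc_last, Fin.val_last]
  congr 2
  refine Matrix.ext fun α γ ↦ ?_
  simp [Fin.succAbove_last]

lemma detForm_mu_tmul {d N : ℕ} (p : Fin (N + 1) → Fin 2 → K)
    (x : ⋀[F]^N (SymPow F d (E F))) (w : SymPow F d (E F)) :
    detForm d p (mu F N (SymPow F d (E F)) (x ⊗ₜ w)) =
      ∑ β : Fin (N + 1), (-1) ^ (N + β.val) * evalSym d (p β) w *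
        detForm d (fun α ↦ p (β.succAbove α)) x := by
  have hx : x ∈ Submodule.span F (Set.range (exteriorPower.ιMulti F N)) := by
    rw [exteriorPower.ιMulti_span]
    exact Submodule.mem_top
  induction hx using Submodule.span_induction with
  | mem x hx =>
    obtain ⟨v, rfl⟩ := hx
    rw [mu_ιMulti_tmul, detForm_ιMulti_snoc]
  | zero => simp
  | add x y _ _ hx hy =>
    simp only [TensorProduct.add_tmul, map_add, hx, hy, mul_add, Finset.sum_add_distrib]
  | smul a x _ hx =>
    simp only [← TensorProduct.smul_tmul', map_smul, hx, mul_smul_comm, Finset.smul_sum]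

lemma detForm_mu {d N : ℕ} (p : Fin (N + 1) → Fin 2 → K)
    (t : (⋀[F]^N (SymPow F d (E F))) ⊗[F] SymPow F d (E F)) :
    detForm d p (mu F N (SymPow F d (E F)) t) =
      ∑ β : Fin (N + 1), (-1) ^ (N + β.val) *
        evalExtTensor d (fun α ↦ p (β.succAbove α)) (p β) t := by
  induction t with
  | zero => simp
  | tmul x w =>
    rw [detForm_mu_tmul]
    refine Finset.sum_congr rfl fun β _ ↦ ?_
    rw [evalExtTensor_tmul]
    ring
  | add x y hx hy => simp only [map_add, hx, hy, mul_add, Finset.sum_add_distrib]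

lemma cons_succAbove_eq {A : Type*} {N : ℕ} (p : Fin (N + 1) → A) (β : Fin (N + 1)) :
    (Fin.cons (p β) fun α ↦ p (β.succAbove α) : Fin (N + 1) → A) = p ∘ β.cycleRange.symm := by
  funext α
  induction α using Fin.cases with
  | zero => simp
  | succ α => simp

/-- Bringing `p β` to the front is a cycle of length `β + 1`. -/
lemma detForm_cons_succAbove (c : ℕ) {N : ℕ} (p : Fin (N + 1) → Fin 2 → K) (β : Fin (N + 1))
    (x : ⋀[F]^(N + 1) (SymPow F c (E F))) :
    detForm c (Fin.cons (p β) fun α ↦ p (β.succAbove α) : Fin (N + 1) → Fin 2 → K) x =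
      (-1) ^ β.val * detForm c p x := by
  rw [cons_succAbove_eq, detForm_comp_perm, Equiv.Perm.sign_symm, Fin.sign_cycleRange]
  simp

/-- The sum is the coefficient of degree `N` in the Lagrange interpolant of `X ^ s` at `N + 1`
nodes. That interpolant is `X ^ s` itself. -/
lemma sum_pow_div_prod_sub {N : ℕ} (τ : Fin (N + 1) → K) (hτ : Function.Injective τ) {s : ℕ}
    (hs : s < N) :
    ∑ β, τ β ^ s / ∏ α : Fin N, (τ β - τ (β.succAbove α)) = 0 := by
  have h := Lagrange.coeff_eq_sum (s := Finset.univ) (hτ.injOn) (P := Polynomial.X ^ s)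
    (by
      rw [Polynomial.degree_X_pow, Finset.card_univ, Fintype.card_fin]
      exact_mod_cast hs.trans N.lt_succ_self)
  rw [Polynomial.coeff_X_pow, if_neg (by simp; omega)] at h
  rw [h]
  refine Finset.sum_congr rfl fun β _ ↦ ?_
  rw [Polynomial.eval_pow, Polynomial.eval_X, ← Finset.compl_singleton, ← Fin.image_succAbove_univ,
    Finset.prod_image fun _ _ _ _ h ↦ Fin.succAbove_right_injective h]

lemma neg_one_pow_mul_eq {w x y z : K} {m n : ℕ} (hz : z ≠ 0)
    (h : w * z = x * ((-1) ^ n * y)) :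
    (-1) ^ (m + n) * w = y * (x / ((-1) ^ m * z)) := by
  have h₁ : ((-1 : K) ^ m) ^ 2 = 1 := by rw [← pow_mul, mul_comm, pow_mul]; simp
  have h₂ : ((-1 : K) ^ n) ^ 2 = 1 := by rw [← pow_mul, mul_comm, pow_mul]; simp
  have h₃ : ((-1 : K) ^ m) ≠ 0 := pow_ne_zero _ (by simp)
  rw [← mul_div_assoc, eq_div_iff (mul_ne_zero h₃ hz), pow_add]
  linear_combination ((-1 : K) ^ m) ^ 2 * (-1) ^ n * h + (((-1 : K) ^ n) ^ 2 * x * y) * h₁ +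
    x * y * h₂

lemma evalExtTensor_phi_succAbove {N d : ℕ} (hN : 1 ≤ N) (p : Fin (N + 1) → Fin 2 → K)
    (hp₀ : ∀ β, p β 0 = 1) (s : Fin (N - 1 + 1)) (x : ⋀[F]^(N + 1) (SymPow F (d + 1) (E F)))
    (β : Fin (N + 1)) :
    evalExtTensor d (fun α ↦ p (β.succAbove α)) (p β)
          (phi F N d hN (monomial F (N - 1) s ⊗ₜ x)) *
        ∏ α : Fin N, (p (β.succAbove α) 1 * p β 0 - p β 1 * p (β.succAbove α) 0) =
      p β 1 ^ s.val * ((-1) ^ β.val * detForm (d + 1) p x) := by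
  have hβ : p β 0 ≠ 0 := by rw [hp₀]; exact one_ne_zero
  have hmon : evalSym (F := F) (N - 1) (p β) (monomial F (N - 1) s) = p β 1 ^ s.val := by
    rw [evalSym_monomial, hp₀, one_pow, one_mul]
  exact (evalExtTensor_phi hN (fun α ↦ p (β.succAbove α)) (p β) hβ
    (monomial F (N - 1) s ⊗ₜ x)).trans ((evalTensorExt_tmul _ _ _ _ _ _).trans
      (congrArg₂ (· * ·) hmon (detForm_cons_succAbove (d + 1) p β x)))

/-- The Laplace sign cancels: `(-1)^β` against moving `p β` to the front, `(-1)^N` against reversing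
the `N` brackets. The factor `detForm (d + 1) p x` no longer depends on `β`. -/
lemma neg_one_pow_mul_evalExtTensor_phi {N d : ℕ} (hN : 1 ≤ N) (p : Fin (N + 1) → Fin 2 → K)
    (hp₀ : ∀ β, p β 0 = 1) (hp₁ : Function.Injective fun β ↦ p β 1) (s : Fin (N - 1 + 1))
    (x : ⋀[F]^(N + 1) (SymPow F (d + 1) (E F))) (β : Fin (N + 1)) :
    (-1) ^ (N + β.val) * evalExtTensor d (fun α ↦ p (β.succAbove α)) (p β)
          (phi F N d hN (monomial F (N - 1) s ⊗ₜ x)) =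
      detForm (d + 1) p x * (p β 1 ^ s.val / ∏ α : Fin N, (p β 1 - p (β.succAbove α) 1)) := by
  have hprod : ∏ α : Fin N, (p β 1 - p (β.succAbove α) 1) = (-1) ^ N *
      ∏ α : Fin N, (p (β.succAbove α) 1 * p β 0 - p β 1 * p (β.succAbove α) 0) := by
    simp_rw [← neg_sub (p (β.succAbove _) 1) (p β 1), hp₀, mul_one]
    rw [Finset.prod_neg, Finset.card_univ, Fintype.card_fin]
  have hne : ∏ α : Fin N, (p (β.succAbove α) 1 * p β 0 - p β 1 * p (β.succAbove α) 0) ≠ 0 := by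
    simp_rw [hp₀, mul_one]
    exact Finset.prod_ne_zero_iff.2 fun α _ ↦ sub_ne_zero.2 fun h ↦ Fin.succAbove_ne β α (hp₁ h)
  exact (neg_one_pow_mul_eq hne (evalExtTensor_phi_succAbove hN p hp₀ s x β)).trans
    (congrArg (fun z ↦ detForm (d + 1) p x * (p β 1 ^ s.val / z)) hprod.symm)

lemma detForm_mu_phi_tmul {N d : ℕ} (hN : 1 ≤ N) (p : Fin (N + 1) → Fin 2 → K)
    (hp₀ : ∀ β, p β 0 = 1) (hp₁ : Function.Injective fun β ↦ p β 1) (s : Fin (N - 1 + 1))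
    (x : ⋀[F]^(N + 1) (SymPow F (d + 1) (E F))) :
    detForm d p (mu F N (SymPow F d (E F)) (phi F N d hN (monomial F (N - 1) s ⊗ₜ x))) = 0 := by
  refine (detForm_mu p _).trans ((Finset.sum_congr rfl fun β _ ↦
    neg_one_pow_mul_evalExtTensor_phi hN p hp₀ hp₁ s x β).trans ?_)
  rw [← Finset.mul_sum, sum_pow_div_prod_sub _ hp₁ (by have := s.isLt; omega), mul_zero]

end Kernel

/-! ### `φ` is an isomorphism -/

section Iso

variable (F : Type*) [Field F] (N d : ℕ) (hN : 1 ≤ N)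

lemma phi_mem_Delta (t : SymPow F (N - 1) (E F) ⊗[F] (⋀[F]^(N + 1) (SymPow F (d + 1) (E F)))) :
    phi F N d hN t ∈ Delta F N (SymPow F d (E F)) := by
  have h : mu F N (SymPow F d (E F)) ∘ₗ phi F N d hN = 0 := by
    refine ((symBasis F (N - 1)).tensorProduct (wedgeBasis F (d + 1) (N + 1))).ext fun ⟨s, k⟩ ↦ ?_
    refine (congrArg _ (tensorBasis_apply F N d s k)).trans
      (detForm_genericPoint_injective F d (N + 1) ?_)
    refine (detForm_mu_phi_tmul hN (fun β : Fin (N + 1) ↦ genericPoint F β.succ)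
      (fun β ↦ genericPoint_zero F β.succ)
      ((genericPoint_one_injective F).comp (Fin.succ_injective _)) s _).trans ?_
    exact (map_zero (detForm (F := F) d fun β : Fin (N + 1) ↦ genericPoint F β.succ)).symm
  exact LinearMap.congr_fun h t

/-- For varying `β` these are Vandermonde equations in the unknowns `detForm (d + 1) p (G s)`, which
are the same for every `β`. -/
lemma sum_pow_mul_detForm_eq_zero {K : Type*} [Field K] [Algebra F K] (p : Fin (N + 1) → Fin 2 → K)
    (hp₀ : ∀ β, p β 0 = 1) (G : Fin (N - 1 + 1) → ⋀[F]^(N + 1) (SymPow F (d + 1) (E F)))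
    (hG : phi F N d hN (∑ s, monomial F (N - 1) s ⊗ₜ G s) = 0) (β : Fin (N + 1)) :
    ∑ s, p β 1 ^ s.val * detForm (d + 1) p (G s) = 0 := by
  have h₁ : ∑ s, evalExtTensor d (fun α ↦ p (β.succAbove α)) (p β)
      (phi F N d hN (monomial F (N - 1) s ⊗ₜ G s)) = 0 := by
    refine (map_sum (evalExtTensor (F := F) d (fun α ↦ p (β.succAbove α)) (p β) ∘ₗ
      phi F N d hN) _ _).symm.trans ?_
    exact (congrArg (evalExtTensor (F := F) d (fun α ↦ p (β.succAbove α)) (p β)) hG).trans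
      (map_zero (evalExtTensor (F := F) d (fun α ↦ p (β.succAbove α)) (p β)))
  have h₂ := congrArg
    (· * ∏ α : Fin N, (p (β.succAbove α) 1 * p β 0 - p β 1 * p (β.succAbove α) 0)) h₁
  have h₃ := ((Finset.sum_mul _ _ _).symm.trans h₂).trans (zero_mul _)
  have h₄ := (Finset.sum_congr rfl fun s _ ↦
    (evalExtTensor_phi_succAbove hN p hp₀ s (G s) β).symm).trans h₃
  simp_rw [mul_left_comm _ ((-1 : K) ^ β.val)] at h₄
  rw [← Finset.mul_sum] at h₄
  exact (mul_eq_zero.1 h₄).resolve_left (pow_ne_zero _ (by simp))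

lemma exists_sum_tmul_eq {ι M M' : Type*} [Fintype ι] [AddCommMonoid M] [Module F M]
    [AddCommMonoid M'] [Module F M'] (b : Module.Basis ι F M) {f : ι → M} (hf : ∀ i, b i = f i)
    (t : M ⊗[F] M') : ∃ c : ι → M', ∑ i, f i ⊗ₜ c i = t := by
  obtain ⟨c, hc⟩ := TensorProduct.eq_repr_basis_left b t
  refine ⟨c, ?_⟩
  rw [← hc, Finsupp.sum_fintype _ _ fun _ ↦ TensorProduct.tmul_zero _ _]
  exact Finset.sum_congr rfl fun i _ ↦ by rw [hf]

lemma phi_injective : Function.Injective (phi F N d hN) := by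
  refine (injective_iff_map_eq_zero _).2 fun t ht ↦ ?_
  obtain ⟨c, hc⟩ := exists_sum_tmul_eq F (symBasis F (N - 1)) (symBasis_apply F (N - 1)) t
  -- There are `N` unknowns, so only `N` of the `N + 1` available points are used, to get a square
  -- system.
  have h := Matrix.eq_zero_of_forall_index_sum_pow_mul_eq_zero
    (f := fun s : Fin (N - 1 + 1) ↦
      genericPoint F (Fin.succ (Fin.castLE (by omega : N - 1 + 1 ≤ N + 1) s)) 1)
    (v := fun s ↦ detForm (d + 1) (fun β : Fin (N + 1) ↦ genericPoint F β.succ) (c s))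
    ((genericPoint_one_injective F).comp
      ((Fin.succ_injective _).comp (Fin.castLE_injective (by omega))))
    fun s ↦ sum_pow_mul_detForm_eq_zero F N d hN
      (fun β : Fin (N + 1) ↦ genericPoint F β.succ) (fun β ↦ genericPoint_zero F β.succ) c
      ((congrArg (phi F N d hN) hc).trans ht) _
  have hc0 : ∀ s, c s = 0 := fun s ↦ detForm_genericPoint_injective F (d + 1) (N + 1)
    ((congrFun h s).trans (map_zero (detForm (F := F) (d + 1) _)).symm)
  rw [← hc]
  exact Finset.sum_eq_zero fun s _ ↦
    (congrArg _ (hc0 s)).trans (TensorProduct.tmul_zero _ (monomial F (N - 1) s))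

/-- The coordinate is `g 0 0 + g 1 0 * x_β`, and the first column of `g` is nonzero. This lets
`evalExtTensor_phi` be applied at the translated point. -/
lemma actPoint_genericPoint_zero_ne_zero {n : ℕ} (g : Matrix.SpecialLinearGroup (Fin 2) F)
    (β : Fin n) : actPoint g (genericPoint F β) 0 ≠ 0 := by
  intro h
  have h' : (MvPolynomial.C (g.1 0 0) + MvPolynomial.C (g.1 1 0) * MvPolynomial.X β :
      MvPolynomial (Fin n) F) = 0 := by
    refine IsFractionRing.injective _ (FractionRing (MvPolynomial (Fin n) F)) ?_
    rw [map_zero, ← h, map_add, map_mul]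
    simp [actPoint, genericPoint, Algebra.smul_def, MvPolynomial.algebraMap_eq,
      IsScalarTower.algebraMap_apply F (MvPolynomial (Fin n) F)
        (FractionRing (MvPolynomial (Fin n) F))]
  have h₀ : g.1 0 0 = 0 := by
    simpa using congrArg (MvPolynomial.eval fun _ ↦ (0 : F)) h'
  have h₁ : g.1 1 0 = 0 := by
    simpa [h₀] using congrArg (MvPolynomial.eval fun _ ↦ (1 : F)) h'
  have hdet := g.2
  rw [Matrix.det_fin_two, h₀, h₁] at hdet
  simp at hdet

/-- The bracket is a `2 × 2` determinant, which the action multiplies by `det g = 1`. -/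
lemma actPoint_mul_sub_mul {K : Type*} [Field K] [Algebra F K]
    (g : Matrix.SpecialLinearGroup (Fin 2) F) (p q : Fin 2 → K) :
    actPoint g p 1 * actPoint g q 0 - actPoint g q 1 * actPoint g p 0 =
      p 1 * q 0 - q 1 * p 0 := by
  have hdet := congrArg (algebraMap F K) g.2
  rw [Matrix.det_fin_two, map_sub, map_mul, map_mul, map_one] at hdet
  simp only [actPoint, Algebra.smul_def]
  linear_combination (p 1 * q 0 - q 1 * p 0) * hdet

lemma evalExtTensor_phi_tprod {K : Type*} [Field K] [Algebra F K]
    (g : Matrix.SpecialLinearGroup (Fin 2) F) (p : Fin N → Fin 2 → K) (q : Fin 2 → K)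
    (hq : q 0 ≠ 0) (hgq : actPoint g q 0 ≠ 0) (hp : ∏ β, (p β 1 * q 0 - q 1 * p β 0) ≠ 0)
    (t : SymPow F (N - 1) (E F) ⊗[F] (⋀[F]^(N + 1) (SymPow F (d + 1) (E F)))) :
    evalExtTensor d p q (phi F N d hN (((symRep (N - 1) (natRep F)).tprod
        (extRep (N + 1) (symRep (d + 1) (natRep F)))) g t)) =
      evalExtTensor d p q (((extRep N (symRep d (natRep F))).tprod (symRep d (natRep F))) g
        (phi F N d hN t)) := by
  have hcons : (fun β ↦ actPoint g ((Fin.cons q p : Fin (N + 1) → Fin 2 → K) β)) =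
      Fin.cons (actPoint g q) fun β ↦ actPoint g (p β) := by
    funext β
    induction β using Fin.cases with
    | zero => simp
    | succ β => simp
  have h := evalExtTensor_phi hN (fun β ↦ actPoint g (p β)) (actPoint g q) hgq t
  simp_rw [actPoint_mul_sub_mul] at h
  refine mul_right_cancel₀ hp ((evalExtTensor_phi hN p q hq _).trans
    ((evalTensorExt_tprod _ _ g _ _ t).trans ((congrArg (fun r : Fin (N + 1) → Fin 2 → K ↦
      evalTensorExt (N - 1) (d + 1) (actPoint g q) r t) hcons).trans ?_)))
  exact h.symm.trans (congrArg (· * ∏ β, (p β 1 * q 0 - q 1 * p β 0))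
    (evalExtTensor_tprod d g p q (phi F N d hN t)).symm)

lemma phi_tprod (g : Matrix.SpecialLinearGroup (Fin 2) F)
    (t : SymPow F (N - 1) (E F) ⊗[F] (⋀[F]^(N + 1) (SymPow F (d + 1) (E F)))) :
    phi F N d hN (((symRep (N - 1) (natRep F)).tprod
        (extRep (N + 1) (symRep (d + 1) (natRep F)))) g t) =
      ((extRep N (symRep d (natRep F))).tprod (symRep d (natRep F))) g (phi F N d hN t) := by
  refine evalExtTensor_genericPoint_injective F d N (evalExtTensor_phi_tprod F N d hN g _ _ ?_
    (actPoint_genericPoint_zero_ne_zero F g 0) ?_ t)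
  · rw [genericPoint_zero]
    exact one_ne_zero
  · simp_rw [genericPoint_zero, mul_one]
    exact Finset.prod_ne_zero_iff.2 fun β _ ↦ sub_ne_zero.2 fun h ↦
      Fin.succ_ne_zero β (genericPoint_one_injective F h)

lemma finrank_symPow (c : ℕ) : Module.finrank F (SymPow F c (E F)) = c + 1 := by
  rw [Module.finrank_eq_card_basis (symBasis F c), Fintype.card_fin]

instance finite_symPow (c : ℕ) : Module.Finite F (SymPow F c (E F)) :=
  Module.Finite.of_basis (symBasis F c)

/-- Pascal's rule reduces this to `(N + 1) * C(d + 1, N + 1) = (d + 1 - N) * C(d + 1, N)`. The case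
`N > d + 1`, where the subtraction truncates, is trivial. -/
lemma mul_choose_add_choose (N d : ℕ) :
    N * (d + 2).choose (N + 1) + (d + 1).choose (N + 1) = (d + 1).choose N * (d + 1) := by
  have h := Nat.choose_succ_right_eq (d + 1) N
  rw [Nat.choose_succ_succ' (d + 1) N]
  rcases le_or_gt N (d + 1) with hle | hlt
  · obtain ⟨e, he⟩ := Nat.exists_eq_add_of_le hle
    have he' : d + 1 - N = e := by omega
    rw [he'] at h
    generalize (d + 1).choose (N + 1) = a at *
    generalize (d + 1).choose N = b at *
    rw [he]
    linarith
  · rw [Nat.choose_eq_zero_of_lt hlt, Nat.choose_eq_zero_of_lt (hlt.trans N.lt_succ_self)]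
    simp

/-- Rank–nullity for the surjection `μ_N`. -/
lemma finrank_Delta_add {V : Type*} [AddCommGroup V] [Module F V] [Module.Finite F V] {n : ℕ}
    (hV : Module.finrank F V = n) :
    Module.finrank F (Delta F N V) + n.choose (N + 1) = n.choose N * n := by
  have h := LinearMap.finrank_range_add_finrank_ker (V := (⋀[F]^N V) ⊗[F] V) (mu F N V)
  rw [LinearMap.range_eq_top.2 (mu_surjective F N _), finrank_top, exteriorPower.finrank_eq,
    Module.finrank_tensorProduct, exteriorPower.finrank_eq, hV] at h
  rw [← h, add_comm]

lemma finrank_tensor_exteriorPower {V W : Type*} [AddCommGroup V] [Module F V] [Module.Finite F V]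
    [AddCommGroup W] [Module F W] [Module.Finite F W] {m n : ℕ} (hV : Module.finrank F V = m)
    (hW : Module.finrank F W = n) (r : ℕ) :
    Module.finrank F (V ⊗[F] (⋀[F]^r W)) = m * n.choose r := by
  rw [Module.finrank_tensorProduct, exteriorPower.finrank_eq, hV, hW]

lemma finrank_eq_finrank_Delta (hN : 1 ≤ N) :
    Module.finrank F (SymPow F (N - 1) (E F) ⊗[F] (⋀[F]^(N + 1) (SymPow F (d + 1) (E F)))) =
      Module.finrank F (Delta F N (SymPow F d (E F))) := by
  have h₁ := finrank_tensor_exteriorPower F (finrank_symPow F (N - 1)) (finrank_symPow F (d + 1))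
    (N + 1)
  have h₂ := finrank_Delta_add F N (finrank_symPow F d)
  rw [← mul_choose_add_choose] at h₂
  rw [Nat.sub_add_cancel hN] at h₁
  exact h₁.trans (Nat.add_right_cancel h₂).symm

lemma exists_eq_of_mem_of_finrank_eq {A B : Type*} [AddCommGroup A] [Module F A] [Module.Finite F A]
    [AddCommGroup B] [Module F B] [Module.Finite F B] (S : Submodule F B) (f : A →ₗ[F] B)
    (hf : Function.Injective f) (hS : ∀ x, f x ∈ S)
    (h : Module.finrank F A = Module.finrank F S) {y : B} (hy : y ∈ S) : ∃ x, f x = y := by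
  have hr : LinearMap.range f = S := Submodule.eq_of_le_of_finrank_eq
    (LinearMap.range_le_iff_comap.2 (eq_top_iff.2 fun x _ ↦ hS x))
    ((LinearMap.finrank_range_of_inj hf).trans h)
  rwa [← LinearMap.mem_range, hr]

lemma exists_phi_eq_of_mem_Delta {y : (⋀[F]^N (SymPow F d (E F))) ⊗[F] SymPow F d (E F)}
    (hy : y ∈ Delta F N (SymPow F d (E F))) : ∃ x, phi F N d hN x = y :=
  exists_eq_of_mem_of_finrank_eq F
    (A := SymPow F (N - 1) (E F) ⊗[F] (⋀[F]^(N + 1) (SymPow F (d + 1) (E F))))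
    (B := (⋀[F]^N (SymPow F d (E F))) ⊗[F] SymPow F d (E F)) (Delta F N (SymPow F d (E F)))
    (phi F N d hN) (phi_injective F N d hN) (phi_mem_Delta F N d hN)
    (finrank_eq_finrank_Delta F N d hN) hy

end Iso

end Plethysm

end

theorem theorem1p1 (F : Type*) [Field F] (N d : ℕ) (hN : 1 ≤ N) :
    ∃ Φ : Representation.Equiv
        ((Plethysm.symRep (N - 1) (Plethysm.natRep F)).tprod
          (Plethysm.extRep (N + 1) (Plethysm.symRep (d + 1) (Plethysm.natRep F))))
        (Plethysm.deltaRep N (Plethysm.symRep d (Plethysm.natRep F))),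
      ∀ x, (Φ x : (⋀[F]^N (Plethysm.SymPow F d (Plethysm.E F))) ⊗[F]
        Plethysm.SymPow F d (Plethysm.E F)) = Plethysm.phi F N d hN x := by
  let f := (Plethysm.phi F N d hN).codRestrict _ (Plethysm.phi_mem_Delta F N d hN)
  have hf : Function.Injective f := fun x y h ↦
    Plethysm.phi_injective F N d hN (congrArg Subtype.val h)
  have hf' : Function.Surjective f := fun y ↦
    (Plethysm.exists_phi_eq_of_mem_Delta F N d hN y.2).imp fun _ h ↦ Subtype.ext h
  let e := LinearEquiv.ofBijective f ⟨hf, hf'⟩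
  refine ⟨Representation.Equiv.mk e fun g ↦ LinearMap.ext fun x ↦ Subtype.ext ?_, fun x ↦ rfl⟩
  exact Plethysm.phi_tprod F N d hN g x
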